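/- A polymatroid is a pair $(Q,f)$ with $Q$ a finite set and $f\colon 2^Q\to\mathbb R$ satisfying $f(\emptyset)=0$, $f(X)\le f(Y)$ for $X\subseteq Y$, and $f(X\cap Y)+f(X\cup Y)\le f(X)+f(Y)$. A matroid is identified with the polymatroid given by its rank function. Write $f(Y{:}Z|X)=f(X\cup Y)+f(X\cup Z)-f(X\cup Y\cup Z)-f(X)$, $f(Y{:}Z)=f(Y{:}Z|\emptyset)$ and $f(Y|X)=f(X\cup Y)-f(X)$. The polymatroid $(Q,f)$ is Ingleton-compliant if $f(A_2{:}A_3)\le f(A_2{:}A_3|A_1)+f(A_2{:}A_3|A_4)+f(A_1{:}A_4)$ for all $A_1,A_2,A_3,A_4\subseteq Q$. It is $1$-CI-compliant if for all $A,B\subseteq Q$ there is a polymatroid $(Q\cup\{x_o\},f)$ extending it, with one new point $x_o$, such that $f(x_o|A)=f(x_o|B)=0$ and $f(x_o)=f(A{:}B)$. For $k>1$ it is $k$-CI-compliant if for all $A,B\subseteq Q$ such an extension exists that is moreover $(k-1)$-CI-compliant. It is CI-compliant if it is $k$-CI-compliant for every $k\ge 1$. A matroid $(Q,r)$ is folded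 linear if there are a positive integer $\ell$, a field $\mathbb F$, a finite-dimensional $\mathbb F$-vector space $V$ and subspaces $(V_x)_{x\in Q}$ of $V$ such that $\ell\, r(X)=\dim\sum_{x\in X}V_x$ for all $X\subseteq Q$. A matroid of rank $k$ is sparse paving if every circuit has rank $k$ or $k-1$ and every circuit of rank $k-1$ is a flat; the circuits of rank $k-1$ are then its circuit-hyperplanes. A sparse paving matroid is determined by its ground set, its rank and its circuit-hyperplanes. Let $Q=\{0,1,2\}\times\{0,1,2\}$ and $C_{ab}=\{(i,j)\in Q: i=a\text{ or }j=b\}$. The tic-tac-toe matroid is the sparse paving matroid of rank $5$ on $Q$ whose circuit-hyperplanes are the eight sets $C_{ab}$ with $(a,b)\neq(1,1)$. Theorem. The table in the formal statement below lists 171 families of $5$-element subsets of $Q$, each of them containing the eight sets $C_{ab}$ with $(a,b)\ne(1,1)$. Each family is the set of circuit-hyperplanes of a sparse paving matroid of rank $5$ on the nine points of $Q$. The 171 matroids obtained in this way are pairwise non-isomorphic, and the first one is the tic-tac-toe matroid. All of them are Ingleton-compliant, none of them is CI-compliant, and hence none of them is folded linear. -/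

import Mathlib

open Finset

universe u v

/-! ### Polymatroids, given by their rank functions -/

/-- `f` is the rank function of a polymatroid with ground set `Q`. -/
structure IsPolymatroid {Q : Type u} [DecidableEq Q] (f : Finset Q → ℝ) : Prop where
  map_empty : f ∅ = 0
  mono : ∀ X Y : Finset Q, X ⊆ Y → f X ≤ f Y
  submodular : ∀ X Y : Finset Q, f (X ∩ Y) + f (X ∪ Y) ≤ f X + f Y

/-- `f(Y : Z | X) = f(XY) + f(XZ) - f(XYZ) - f(X)`. -/
def condMutual {Q : Type u} [DecidableEq Q] (f : Finset Q → ℝ) (Y Z X : Finset Q) : ℝ :=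
  f (X ∪ Y) + f (X ∪ Z) - f (X ∪ Y ∪ Z) - f X

/-- `f(Y : Z) = f(Y : Z | ∅)`. -/
def mutualRank {Q : Type u} [DecidableEq Q] (f : Finset Q → ℝ) (Y Z : Finset Q) : ℝ :=
  condMutual f Y Z ∅

/-- `f(Y | X) = f(Y : Y | X)`, which equals `f(XY) - f(X)`. -/
def condRank {Q : Type u} [DecidableEq Q] (f : Finset Q → ℝ) (Y X : Finset Q) : ℝ :=
  condMutual f Y Y X

/-- Ingleton's inequality holds for all choices of four subsets of the ground set. -/
def IsIngletonCompliant {Q : Type u} [DecidableEq Q] (f : Finset Q → ℝ) : Prop :=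
  ∀ A₁ A₂ A₃ A₄ : Finset Q,
    mutualRank f A₂ A₃ ≤ condMutual f A₂ A₃ A₁ + condMutual f A₂ A₃ A₄ + mutualRank f A₁ A₄

/-- The set `Xo` is a common information for the pair `(A, B)`. -/
def IsCommonInfo {Q : Type u} [DecidableEq Q] (f : Finset Q → ℝ) (A B Xo : Finset Q) : Prop :=
  condRank f Xo A = 0 ∧ condRank f Xo B = 0 ∧ f Xo = mutualRank f A B

/-- The polymatroid `f'` on `Q` together with one new point `none` extends `f`. -/
def IsOnePointExtension {Q : Type u} [DecidableEq Q] (f : Finset Q → ℝ)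
    (f' : Finset (Option Q) → ℝ) : Prop :=
  IsPolymatroid f' ∧ ∀ X : Finset Q, f' (X.map Function.Embedding.some) = f X

/-- `k`-CI-compliance for `k ≥ 1`; the value at `k = 0` is the empty condition, so that
`1`-CI-compliance only asks for the existence of the extensions. -/
def IsKCICompliant : (k : ℕ) → {Q : Type u} → [DecidableEq Q] → (Finset Q → ℝ) → Prop
  | 0, _, _, _ => True
  | k + 1, Q, _, f => ∀ A B : Finset Q, ∃ f' : Finset (Option Q) → ℝ,
      IsOnePointExtension f f' ∧
      IsCommonInfo f' (A.map Function.Embedding.some) (B.map Function.Embedding.some) {none} ∧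
      IsKCICompliant k f'

/-- CI-compliance: `k`-CI-compliance for every positive integer `k`. -/
def IsCICompliant {Q : Type u} [DecidableEq Q] (f : Finset Q → ℝ) : Prop :=
  ∀ k : ℕ, 1 ≤ k → IsKCICompliant k f

/-- `f(X) = dim ∑_{x ∈ X} V_x` for a family of subspaces of a finite-dimensional space. -/
def IsLinearPolymatroid (F : Type v) [Field F] {Q : Type u} (f : Finset Q → ℝ) : Prop :=
  ∃ (V : Type v) (_ : AddCommGroup V) (_ : Module F V) (_ : Module.Finite F V)
    (W : Q → Submodule F V),
    ∀ X : Finset Q, f X = (Module.finrank F (⨆ x ∈ X, W x : Submodule F V) : ℝ)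

/-- The matroid with rank function `r` is folded linear: for some field and some positive
integer `ℓ`, the polymatroid with rank function `ℓ r` is linear over that field. -/
def IsFoldedLinear {Q : Type u} (r : Finset Q → ℝ) : Prop :=
  ∃ (F : Type v) (_ : Field F) (ℓ : ℕ), 0 < ℓ ∧
    IsLinearPolymatroid F (fun X => (ℓ : ℝ) * r X)

/-! ### Matroids -/

namespace Matroid

/-- The real-valued rank function of a matroid on a finite ground set. -/
noncomputable def realRank {α : Type u} (M : Matroid α) (X : Finset α) : ℝ :=
  ((M.eRk (X : Set α)).toNat : ℝ)

/-- Every circuit has rank `k` or `k - 1`, where `k` is the rank of the matroid. -/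
def IsPaving {α : Type u} (M : Matroid α) : Prop :=
  ∀ C : Set α, M.IsCircuit C → M.eRk C = M.eRank ∨ M.eRk C + 1 = M.eRank

/-- Paving, and all circuits of rank `k - 1` are flats. -/
def IsSparsePaving {α : Type u} (M : Matroid α) : Prop :=
  M.IsPaving ∧ ∀ C : Set α, M.IsCircuit C → M.eRk C + 1 = M.eRank → M.IsFlat C

/-- A circuit that is also a flat of rank `k - 1`. -/
def IsCircuitHyperplane {α : Type u} (M : Matroid α) (C : Set α) : Prop :=
  M.IsCircuit C ∧ M.IsFlat C ∧ M.eRk C + 1 = M.eRank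

/-- Two matroids on full ground types are isomorphic. -/
def IsIsomorphic {α : Type u} {β : Type v} (M : Matroid α) (N : Matroid β) : Prop :=
  ∃ e : α ≃ β, M.mapEquiv e = N

end Matroid

/-! ### The list of 171 matroids -/

/-- The nine points: the cells of a `3 × 3` grid. -/
abbrev Cell : Type := Fin 3 × Fin 3

/-- The union of row `a` and column `b`, where `p = (a, b)`; a set of five cells. -/
def cross (p : Cell) : Finset Cell :=
  univ.filter fun q => q.1 = p.1 ∨ q.2 = p.2

/-- The circuit-hyperplanes of the tic-tac-toe matroid: all crosses but the central one. -/
def ticTacToe : Finset (Finset Cell) :=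
  (univ.filter fun p : Cell => p ≠ (1, 1)).image cross

/-- The set of cells coded by a natural number: cell `(i, j)` is in it if the binary digit of
weight `2 ^ (3 * i + j)` is `1`. -/
def cellsOf (m : ℕ) : Finset Cell :=
  univ.filter fun q => m.testBit (3 * q.1.val + q.2.val) = true

/-- Each of the 171 matroids is written on the grid so that the circuit-hyperplanes of the
tic-tac-toe matroid are among its circuit-hyperplanes; this table lists the codes of its further
circuit-hyperplanes. The first entry is the tic-tac-toe matroid itself. -/
def furtherCodes : List (List ℕ) :=
  [[], [118], [171], [173], [341], [118, 171], [118, 173], [118, 174], [118, 220], [118, 227],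
   [118, 234], [118, 283], [118, 341], [171, 341], [171, 362], [173, 227], [173, 341],
   [173, 362], [118, 171, 220], [118, 171, 283], [118, 171, 341], [118, 171, 362],
   [118, 171, 398], [118, 171, 433], [118, 173, 220], [118, 173, 227], [118, 173, 234],
   [118, 173, 283], [118, 173, 341], [118, 173, 362], [118, 173, 398], [118, 173, 433],
   [118, 174, 220], [118, 174, 227], [118, 174, 341], [118, 220, 283], [118, 220, 341],
   [118, 227, 341], [118, 227, 362], [118, 227, 433], [118, 234, 341], [118, 283, 341],
   [171, 341, 362], [171, 362, 398], [173, 227, 341], [173, 227, 362], [173, 341, 362],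
   [118, 171, 220, 283], [118, 171, 220, 341], [118, 171, 220, 362], [118, 171, 220, 433],
   [118, 171, 283, 341], [118, 171, 283, 362], [118, 171, 283, 398], [118, 171, 283, 433],
   [118, 171, 341, 362], [118, 171, 341, 398], [118, 171, 341, 433], [118, 171, 362, 398],
   [118, 171, 362, 433], [118, 171, 398, 433], [118, 173, 220, 227], [118, 173, 220, 234],
   [118, 173, 220, 283], [118, 173, 220, 341], [118, 173, 220, 362], [118, 173, 220, 398],
   [118, 173, 220, 433], [118, 173, 227, 283], [118, 173, 227, 341], [118, 173, 227, 362],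
   [118, 173, 227, 398], [118, 173, 227, 433], [118, 173, 234, 341], [118, 173, 234, 398],
   [118, 173, 283, 341], [118, 173, 283, 362], [118, 173, 341, 362], [118, 173, 341, 398],
   [118, 173, 341, 433], [118, 173, 362, 433], [118, 174, 227, 341], [118, 174, 227, 362],
   [118, 220, 283, 341], [118, 220, 283, 433], [118, 227, 341, 362], [118, 227, 341, 433],
   [171, 341, 362, 398], [173, 227, 341, 362], [173, 227, 362, 398], [118, 171, 220, 283, 341],
   [118, 171, 220, 283, 362], [118, 171, 220, 283, 433], [118, 171, 220, 341, 362],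
   [118, 171, 220, 341, 433], [118, 171, 220, 362, 398], [118, 171, 220, 362, 433],
   [118, 171, 283, 341, 362], [118, 171, 283, 341, 398], [118, 171, 283, 362, 398],
   [118, 171, 283, 362, 433], [118, 171, 283, 398, 433], [118, 171, 341, 362, 398],
   [118, 171, 341, 362, 433], [118, 171, 341, 398, 433], [118, 171, 362, 398, 433],
   [118, 173, 220, 227, 283], [118, 173, 220, 227, 341], [118, 173, 220, 227, 362],
   [118, 173, 220, 227, 433], [118, 173, 220, 234, 398], [118, 173, 220, 283, 341],
   [118, 173, 220, 283, 362], [118, 173, 220, 283, 398], [118, 173, 220, 283, 433],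
   [118, 173, 220, 341, 362], [118, 173, 220, 341, 398], [118, 173, 220, 341, 433],
   [118, 173, 227, 283, 341], [118, 173, 227, 283, 362], [118, 173, 227, 283, 398],
   [118, 173, 227, 341, 362], [118, 173, 227, 341, 398], [118, 173, 227, 341, 433],
   [118, 173, 227, 362, 398], [118, 173, 227, 362, 433], [118, 173, 234, 341, 398],
   [118, 173, 283, 341, 362], [118, 173, 341, 362, 433], [118, 174, 227, 341, 362],
   [118, 220, 283, 341, 433], [173, 227, 341, 362, 398], [118, 171, 220, 283, 341, 362],
   [118, 171, 220, 283, 362, 398], [118, 171, 220, 283, 362, 433],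
   [118, 171, 220, 341, 362, 398], [118, 171, 220, 341, 362, 433],
   [118, 171, 220, 362, 398, 433], [118, 171, 283, 341, 362, 398],
   [118, 171, 283, 362, 398, 433], [118, 171, 341, 362, 398, 433],
   [118, 173, 220, 227, 283, 341], [118, 173, 220, 227, 283, 362],
   [118, 173, 220, 227, 283, 433], [118, 173, 220, 227, 341, 362],
   [118, 173, 220, 227, 341, 433], [118, 173, 220, 227, 362, 398],
   [118, 173, 220, 227, 362, 433], [118, 173, 220, 283, 341, 362],
   [118, 173, 220, 283, 341, 398], [118, 173, 220, 283, 341, 433],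
   [118, 173, 220, 283, 362, 433], [118, 173, 227, 283, 341, 362],
   [118, 173, 227, 283, 341, 398], [118, 173, 227, 283, 362, 398],
   [118, 173, 227, 341, 362, 398], [118, 173, 227, 341, 362, 433],
   [118, 171, 220, 283, 341, 362, 398], [118, 171, 220, 283, 362, 398, 433],
   [118, 171, 220, 341, 362, 398, 433], [118, 173, 220, 227, 283, 341, 362],
   [118, 173, 220, 227, 283, 341, 433], [118, 173, 220, 227, 283, 362, 398],
   [118, 173, 220, 227, 283, 362, 433], [118, 173, 220, 227, 341, 362, 398],
   [118, 173, 220, 227, 341, 362, 433], [118, 173, 220, 283, 341, 362, 433],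
   [118, 173, 227, 283, 341, 362, 398], [118, 173, 220, 227, 283, 341, 362, 398],
   [118, 173, 220, 227, 283, 362, 398, 433], [118, 173, 220, 227, 283, 341, 362, 398, 433]]

theorem furtherCodes_length : furtherCodes.length = 171 := by
  rfl

/-- The circuit-hyperplanes of the `k`-th matroid of the list. -/
def listedCircuitHyperplanes (k : Fin 171) : Finset (Finset Cell) :=
  ticTacToe ∪ ((furtherCodes.get (k.cast furtherCodes_length.symm)).map cellsOf).toFinset

/-! ### Sparse paving matroids -/

/-! Five-element sets that pairwise meet in at most three points are the dependent five-element sets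
of a sparse paving matroid of rank 5, and its rank function is explicit (`sparsePaving_eRk`).

Ingleton's inequality follows from submodularity as soon as one of the unions A∪B, A∪C, D∪B, D∪C,
B∪C is spanning or splits modularly. In a sparse paving matroid this covers every union that is not
a circuit-hyperplane. If all five are circuit-hyperplanes, counting ranks leaves only a Vámos-like
configuration (`sparsePaving_isIngletonCompliant`), which a finite check on the table excludes.

CI-compliance fails already at depth 2 (`IsPolymatroid.grid_contradiction`). Let q and s be common
informations of row 0 with row 1 and with row 2; both have rank 1. Columns 0 and 2 determine q and s
and have mutual rank 1, so q and s determine each other. Hence the middle row and the middle column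
both determine s and the point (1,1). Their mutual rank is also 1, because the central cross is a
basis, so s determines (1,1). Then row 0 determines (1,1), which is false. The argument survives
scaling by any c > 0. Linear polymatroids are CI-compliant, so no positive multiple of the rank
function is linear.

Non-isomorphism holds because `tripleInvariant` takes 171 different values. -/

namespace Matroid

/-- A family of `d`-element sets, any two of which differ in at least two elements. -/
structure IsSparseFamily {α : Type u} [DecidableEq α] (d : ℕ) (H : Finset (Finset α)) : Prop where
  pos : 0 < d
  card_eq : ∀ A ∈ H, A.card = d
  inter_card : ∀ A ∈ H, ∀ B ∈ H, A ≠ B → (A ∩ B).card + 2 ≤ d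

variable {α : Type u} [DecidableEq α] {d : ℕ} {H : Finset (Finset α)}

/-- Two different members would share the d - 1 elements of I. So a set of size d - 1 has at most
one extension to a member; this drives both the augmentation axiom and the rank formula. -/
theorem IsSparseFamily.eq_of_insert (hH : IsSparseFamily d H) {I : Finset α} {a b : α}
    (ha : a ∉ I) (haH : insert a I ∈ H) (hbH : insert b I ∈ H) : a = b := by
  by_contra hab
  have hne : insert a I ≠ insert b I := fun h => by
    have : a ∈ insert b I := h ▸ mem_insert_self a I
    simp_all
  have h₁ := hH.inter_card _ haH _ hbH hne
  have h₂ := hH.card_eq _ haH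
  rw [card_insert_of_notMem ha] at h₂
  have h₃ := card_le_card (subset_inter (subset_insert a I) (subset_insert b I))
  omega

/-- The sparse paving matroid of rank `d` with circuit-hyperplanes `H`. -/
def sparsePaving (H : Finset (Finset α)) (hH : IsSparseFamily d H) : Matroid α :=
  (IndepMatroid.ofFinset Set.univ (fun I => I.card ≤ d ∧ I ∉ H)
    -- Positivity of d keeps the empty set out of H.
    ⟨by simp, fun h => by have := hH.card_eq _ h; have := hH.pos; simp at *; omega⟩
    (by
      rintro I J ⟨hJ, hJH⟩ hIJ
      refine ⟨(card_le_card hIJ).trans hJ, fun hI => hJH ?_⟩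
      rwa [← eq_of_subset_of_card_le hIJ (hJ.trans_eq (hH.card_eq _ hI).symm)])
    (by
      rintro I J ⟨hI, hIH⟩ ⟨hJ, hJH⟩ hlt
      by_cases hIJ : I ⊆ J
      · obtain ⟨e, heJ, heI⟩ := exists_of_ssubset (hIJ.ssubset_of_ne (by rintro rfl; omega))
        refine ⟨e, heJ, heI, by rw [card_insert_of_notMem heI]; omega, fun h => hJH ?_⟩
        have h₁ := hH.card_eq _ h
        rwa [← eq_of_subset_of_card_le (insert_subset heJ hIJ) (by omega)]
      -- Here |J ∩ I| < |I| < |J|, so there are two candidates for augmentation, and at most one of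
      -- them completes I to a member of H.
      · have h₂ : 1 < (J \ I).card := by
          have := card_sdiff_add_card_inter J I
          have : (J ∩ I).card < I.card := card_lt_card
            ⟨inter_subset_right, fun h => hIJ (h.trans inter_subset_left)⟩
          omega
        obtain ⟨a, ha, b, hb, hab⟩ := one_lt_card.1 h₂
        rw [mem_sdiff] at ha hb
        by_cases haH : insert a I ∈ H
        · exact ⟨b, hb.1, hb.2, by rw [card_insert_of_notMem hb.2]; omega,
            fun h => hab (hH.eq_of_insert ha.2 haH h)⟩
        · exact ⟨a, ha.1, ha.2, by rw [card_insert_of_notMem ha.2]; omega, haH⟩)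
    (by simp)).matroid

variable {hH : IsSparseFamily d H}

@[simp]
theorem sparsePaving_ground : (sparsePaving H hH).E = Set.univ := rfl

@[simp]
theorem sparsePaving_indep_iff {I : Finset α} :
    (sparsePaving H hH).Indep (I : Set α) ↔ I.card ≤ d ∧ I ∉ H := by
  simp only [sparsePaving, IndepMatroid.matroid_Indep, IndepMatroid.ofFinset_indep]

theorem sparsePaving_isCircuit_of_mem {C : Finset α} (hC : C ∈ H) :
    (sparsePaving H hH).IsCircuit (C : Set α) := by
  rw [isCircuit_iff_dep_forall_sdiff_singleton_indep]
  refine ⟨⟨fun h => (sparsePaving_indep_iff.1 h).2 hC, Set.subset_univ _⟩, fun e he => ?_⟩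
  have h := hH.card_eq _ hC
  have h' := hH.pos
  rw [← coe_singleton, ← coe_sdiff, sdiff_singleton_eq_erase, sparsePaving_indep_iff,
    card_erase_of_mem (by simpa using he)]
  refine ⟨by omega, fun h₁ => ?_⟩
  have := hH.card_eq _ h₁
  rw [card_erase_of_mem (by simpa using he)] at this
  omega

/-- The rank function of a sparse paving matroid. -/
theorem sparsePaving_eRk (X : Finset α) :
    (sparsePaving H hH).eRk (X : Set α) = ((if X ∈ H then d - 1 else min X.card d : ℕ) : ℕ∞) := by
  split_ifs with hX
  · have h := (sparsePaving_isCircuit_of_mem (hH := hH) hX).eRk_add_one_eq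
    have h' := hH.pos
    rw [Set.encard_coe_eq_coe_finsetCard, hH.card_eq _ hX] at h
    have h₁ : (d : ℕ∞) = ((d - 1 : ℕ) : ℕ∞) + 1 := by exact_mod_cast (Nat.sub_add_cancel h').symm
    exact ENat.add_left_injective_of_ne_top ENat.one_ne_top (h.trans h₁)
  · apply le_antisymm
    · rw [Monotone.map_min (f := ((↑) : ℕ → ℕ∞)) Nat.mono_cast, le_min_iff]
      refine ⟨((sparsePaving H hH).eRk_le_encard X).trans_eq (Set.encard_coe_eq_coe_finsetCard X),
        eRk_le_iff.2 fun I hIX hI => ?_⟩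
      lift I to Finset α using X.finite_toSet.subset hIX
      rw [Set.encard_coe_eq_coe_finsetCard]
      exact_mod_cast (sparsePaving_indep_iff.1 hI).1
    · suffices h : ∃ I ⊆ X, I ∉ H ∧ I.card = min X.card d by
        obtain ⟨I, hIX, hIH, hI⟩ := h
        rw [← hI, ← Set.encard_coe_eq_coe_finsetCard]
        exact (sparsePaving_indep_iff.2 ⟨hI.trans_le (min_le_right _ _), hIH⟩).encard_le_eRk_of_subset
          (by exact_mod_cast hIX)
      rcases le_or_gt X.card d with hd | hd
      · exact ⟨X, Subset.rfl, hX, by omega⟩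
      have hpos := hH.pos
      -- A subset of size d - 1 has at least two extensions inside X, at most one of which is in H;
      -- another one is a basis.
      obtain ⟨J, hJX, hJ⟩ := exists_subset_card_eq (show d - 1 ≤ X.card by omega)
      have h₂ : 1 < (X \ J).card := by rw [card_sdiff_of_subset hJX]; omega
      obtain ⟨a, ha, b, hb, hab⟩ := one_lt_card.1 h₂
      rw [mem_sdiff] at ha hb
      by_cases haH : insert a J ∈ H
      · exact ⟨insert b J, insert_subset hb.1 hJX,
          fun h => hab (hH.eq_of_insert ha.2 haH h), by
            rw [card_insert_of_notMem hb.2]; omega⟩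
      · exact ⟨insert a J, insert_subset ha.1 hJX, haH, by
            rw [card_insert_of_notMem ha.2]; omega⟩

theorem sparsePaving_realRank (X : Finset α) :
    (sparsePaving H hH).realRank X = ((if X ∈ H then d - 1 else min X.card d : ℕ) : ℝ) := by
  rw [realRank, sparsePaving_eRk, ENat.toNat_natCast]

theorem sparsePaving_eRank [Fintype α] (hd : d < Fintype.card α) :
    (sparsePaving H hH).eRank = d := by
  rw [← eRk_univ_eq, ← coe_univ, sparsePaving_eRk, if_neg, card_univ, min_eq_right hd.le]
  intro h
  have := hH.card_eq _ h
  rw [card_univ] at this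
  omega

theorem sparsePaving_eRk_of_lt_card {X : Finset α} (hX : d < X.card) :
    (sparsePaving H hH).eRk (X : Set α) = d := by
  rw [sparsePaving_eRk, if_neg (fun h => by have := hH.card_eq _ h; omega), min_eq_right hX.le]

/-- A further point yields d + 1 elements, hence rank d instead of d - 1. -/
theorem sparsePaving_isFlat_of_mem {C : Finset α} (hC : C ∈ H) :
    (sparsePaving H hH).IsFlat (C : Set α) := by
  rw [isFlat_iff_closure_eq]
  refine (subset_closure_of_subset _ Set.Subset.rfl).antisymm' fun x hx => ?_
  by_contra hxC
  have h₁ : (sparsePaving H hH).eRk (insert x C : Finset α) ≤ (sparsePaving H hH).eRk (C : Set α) := by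
    rw [← eRk_closure_eq _ (C : Set α), coe_insert]
    exact eRk_mono _ (Set.insert_subset hx (subset_closure_of_subset _ Set.Subset.rfl))
  rw [mem_coe] at hxC
  rw [sparsePaving_eRk_of_lt_card (by rw [card_insert_of_notMem hxC, hH.card_eq _ hC]; omega),
    sparsePaving_eRk, if_pos hC, Nat.cast_le] at h₁
  have := hH.pos
  omega

theorem sparsePaving_mem_of_isCircuit {C : Finset α}
    (hC : (sparsePaving H hH).IsCircuit (C : Set α)) (hd : C.card ≤ d) : C ∈ H := by
  by_contra h
  exact hC.dep.not_indep (sparsePaving_indep_iff.2 ⟨hd, h⟩)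

theorem sparsePaving_eRk_add_one_of_mem {C : Finset α} (hC : C ∈ H) :
    (sparsePaving H hH).eRk (C : Set α) + 1 = d := by
  rw [sparsePaving_eRk, if_pos hC]
  exact_mod_cast Nat.sub_add_cancel hH.pos

theorem sparsePaving_isSparsePaving [Fintype α] (hd : d < Fintype.card α) :
    (sparsePaving H hH).IsSparsePaving := by
  rw [IsSparsePaving, IsPaving, sparsePaving_eRank hd]
  refine ⟨fun C hC => ?_, fun C hC hr => ?_⟩ <;> lift C to Finset α using C.toFinite <;>
    rcases le_or_gt C.card d with h | h
  · exact .inr (sparsePaving_eRk_add_one_of_mem (sparsePaving_mem_of_isCircuit hC h))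
  · exact .inl (sparsePaving_eRk_of_lt_card h)
  · exact sparsePaving_isFlat_of_mem (sparsePaving_mem_of_isCircuit hC h)
  · rw [sparsePaving_eRk_of_lt_card h] at hr
    norm_cast at hr
    omega

theorem sparsePaving_isCircuitHyperplane_iff [Fintype α] (hd : d < Fintype.card α) (C : Finset α) :
    (sparsePaving H hH).IsCircuitHyperplane (C : Set α) ↔ C ∈ H := by
  rw [IsCircuitHyperplane, sparsePaving_eRank hd]
  refine ⟨fun ⟨hC, _, hr⟩ => ?_, fun h => ⟨sparsePaving_isCircuit_of_mem h,
    sparsePaving_isFlat_of_mem h, sparsePaving_eRk_add_one_of_mem h⟩⟩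
  rcases le_or_gt C.card d with h | h
  · exact sparsePaving_mem_of_isCircuit hC h
  · rw [sparsePaving_eRk_of_lt_card h] at hr
    norm_cast at hr
    omega

/-- An isomorphism of sparse paving matroids maps circuit-hyperplanes to circuit-hyperplanes. -/
theorem exists_map_eq_of_isIsomorphic {H' : Finset (Finset α)} {hH' : IsSparseFamily d H'}
    (h : (sparsePaving H hH).IsIsomorphic (sparsePaving H' hH')) :
    ∃ e : α ≃ α, H' = H.map (Finset.mapEmbedding e.toEmbedding).toEmbedding := by
  obtain ⟨e, he⟩ := h
  refine ⟨e, ?_⟩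
  -- Among sets of size d, the members of the family are exactly the dependent ones, and dependence
  -- is preserved by isomorphisms.
  have key : ∀ C : Finset α, C.card = d → (C ∈ H' ↔ C.map e.symm.toEmbedding ∈ H) := by
    intro C hC
    have h₁ : (sparsePaving H' hH').Indep (C : Set α) ↔
        (sparsePaving H hH).Indep (C.map e.symm.toEmbedding : Finset α) := by
      rw [← he, mapEquiv_indep_iff, coe_map]; rfl
    rw [sparsePaving_indep_iff, sparsePaving_indep_iff, card_map] at h₁
    have := hC.le
    tauto
  ext C
  simp only [mem_map, RelEmbedding.coe_toEmbedding, Finset.mapEmbedding_apply]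
  constructor
  · intro hC
    refine ⟨_, (key C (hH'.card_eq _ hC)).1 hC, ?_⟩
    ext x; simp
  · rintro ⟨D, hD, rfl⟩
    rw [key _ (by rw [card_map, hH.card_eq _ hD])]
    convert hD
    ext x; simp

end Matroid

/-! ### Ingleton's inequality -/

namespace IsPolymatroid

variable {Q : Type u} [DecidableEq Q] {f : Finset Q → ℝ}

theorem submodular_of_subset (hf : IsPolymatroid f) {X Y Z W : Finset Q} (hZ : Z ⊆ X ∩ Y)
    (hW : W ⊆ X ∪ Y) : f Z + f W ≤ f X + f Y :=
  (add_le_add (hf.mono _ _ hZ) (hf.mono _ _ hW)).trans (hf.submodular X Y)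

end IsPolymatroid

/-- Ingleton's inequality for four sets, solved for the ranks of their unions. -/
def IngletonAt {Q : Type u} [DecidableEq Q] (f : Finset Q → ℝ) (A B C D : Finset Q) : Prop :=
  f B + f C + f (A ∪ B ∪ C) + f (D ∪ B ∪ C) + f (A ∪ D) ≤
    f (A ∪ B) + f (A ∪ C) + f (D ∪ B) + f (D ∪ C) + f (B ∪ C)

section Ingleton

variable {Q : Type u} [DecidableEq Q] {f : Finset Q → ℝ} {A B C D : Finset Q}

theorem IsPolymatroid.isIngletonCompliant (hf : IsPolymatroid f)
    (h : ∀ A B C D, IngletonAt f A B C D) : IsIngletonCompliant f := by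
  intro A B C D
  have := h A B C D
  simp only [IngletonAt] at this
  simp only [mutualRank, condMutual, empty_union, hf.map_empty]
  linarith

/-- This symmetry and the next one reduce the four unions of an outer with an inner set to A∪B. -/
theorem IngletonAt.swap_inner (h : IngletonAt f A C B D) : IngletonAt f A B C D := by
  simp only [IngletonAt] at *
  rw [union_right_comm A C B, union_right_comm D C B, union_comm C B] at h
  linarith

theorem IngletonAt.swap_outer (h : IngletonAt f D B C A) : IngletonAt f A B C D := by
  simp only [IngletonAt] at *
  rw [union_comm D A] at h
  linarith

namespace IsPolymatroid

/-- Since f(ABC) ≤ f(AB), submodularity for the pairs BC, DB and AC, DC suffices. -/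
theorem ingletonAt_of_spanning_outer (hf : IsPolymatroid f)
    (h : ∀ X, f X ≤ f (A ∪ B)) : IngletonAt f A B C D := by
  have h₁ := hf.submodular_of_subset (X := B ∪ C) (Y := D ∪ B) (Z := B) (W := D ∪ B ∪ C)
    (by grind) (by grind)
  have h₂ := hf.submodular_of_subset (X := A ∪ C) (Y := D ∪ C) (Z := C) (W := A ∪ D)
    (by grind) (by grind)
  have h₃ := h (A ∪ B ∪ C)
  simp only [IngletonAt]
  linarith

theorem ingletonAt_of_spanning_inner (hf : IsPolymatroid f)
    (h : ∀ X, f X ≤ f (B ∪ C)) : IngletonAt f A B C D := by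
  have h₁ := hf.submodular_of_subset (X := A ∪ B) (Y := D ∪ B) (Z := B) (W := A ∪ B ∪ D)
    (by grind) (by grind)
  have h₂ := hf.submodular_of_subset (X := A ∪ C) (Y := D ∪ C) (Z := C) (W := A ∪ C ∪ D)
    (by grind) (by grind)
  have h₃ := hf.submodular_of_subset (X := A ∪ B ∪ D) (Y := A ∪ C ∪ D) (Z := A ∪ D)
    (W := A ∪ B ∪ C) (by grind) (by grind)
  have h₄ := h (D ∪ B ∪ C)
  simp only [IngletonAt]
  linarith

/-- The set B ∩ C acts as a common information of B and C; conditioning on A and on D bounds its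
rank. In the next lemma A ∩ B plays the same role for A and B. -/
theorem ingletonAt_of_modular_inner (hf : IsPolymatroid f)
    (h : f B + f C ≤ f (B ∪ C) + f (B ∩ C)) : IngletonAt f A B C D := by
  have h₁ := hf.submodular_of_subset (X := A ∪ B) (Y := A ∪ C) (Z := A ∪ B ∩ C)
    (W := A ∪ B ∪ C) (by grind) (by grind)
  have h₂ := hf.submodular_of_subset (X := D ∪ B) (Y := D ∪ C) (Z := D ∪ B ∩ C)
    (W := D ∪ B ∪ C) (by grind) (by grind)
  have h₃ := hf.submodular_of_subset (X := A ∪ B ∩ C) (Y := D ∪ B ∩ C) (Z := B ∩ C)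
    (W := A ∪ D) (by grind) (by grind)
  simp only [IngletonAt]
  linarith

theorem ingletonAt_of_modular_outer (hf : IsPolymatroid f)
    (h : f A + f B ≤ f (A ∪ B) + f (A ∩ B)) : IngletonAt f A B C D := by
  have h₁ := hf.submodular_of_subset (X := A ∪ C) (Y := B ∪ C) (Z := A ∩ B ∪ C)
    (W := A ∪ B ∪ C) (by grind) (by grind)
  have h₂ := hf.submodular_of_subset (X := A ∩ B ∪ C) (Y := D ∪ C) (Z := C)
    (W := A ∩ B ∪ C ∪ D) (by grind) (by grind)
  have h₃ := hf.submodular_of_subset (X := A ∩ B ∪ C ∪ D) (Y := D ∪ B) (Z := A ∩ B ∪ D)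
    (W := D ∪ B ∪ C) (by grind) (by grind)
  have h₄ := hf.submodular_of_subset (X := A ∩ B ∪ D) (Y := A) (Z := A ∩ B)
    (W := A ∪ D) (by grind) (by grind)
  simp only [IngletonAt]
  linarith

end IsPolymatroid

end Ingleton

/-! ### Ingleton's inequality in sparse paving matroids of rank 5 -/

namespace Matroid

theorem isPolymatroid_realRank {α : Type u} [DecidableEq α] (M : Matroid α) :
    IsPolymatroid M.realRank := by
  have hfin : ∀ X : Finset α, ∃ n : ℕ, M.eRk (X : Set α) = n := fun X =>
    (ENat.ne_top_iff_exists.1 (ne_top_of_le_ne_top (Set.encard_ne_top_iff.2 X.finite_toSet)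
      (M.eRk_le_encard X))).imp fun _ h => h.symm
  refine ⟨by simp [realRank], fun X Y hXY => ?_, fun X Y => ?_⟩
  · obtain ⟨x, hx⟩ := hfin X
    obtain ⟨y, hy⟩ := hfin Y
    have := M.eRk_mono (coe_subset.2 hXY)
    rw [hx, hy] at this
    rw [realRank, realRank, hx, hy]
    exact_mod_cast this
  · obtain ⟨x, hx⟩ := hfin X
    obtain ⟨y, hy⟩ := hfin Y
    obtain ⟨z, hz⟩ := hfin (X ∩ Y)
    obtain ⟨w, hw⟩ := hfin (X ∪ Y)
    have := M.eRk_inter_add_eRk_union_le X Y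
    rw [← coe_inter, ← coe_union, hx, hy, hz, hw] at this
    rw [realRank, realRank, realRank, realRank, hx, hy, hz, hw]
    exact_mod_cast this

variable {α : Type u} [DecidableEq α] {H : Finset (Finset α)}

/-- There are no four sets of three points with a common point such that the unions of exactly
five of the six pairs of them are in `H`. -/
def NoVamosConfig (H : Finset (Finset α)) : Prop :=
  ∀ T ∈ H, ∀ X ∈ H, (X ∩ T).card = 3 → ∀ Z ∈ H, Z ∩ T = X ∩ T → Z ≠ X →
    ∀ Y ∈ H, X ∩ T ∪ Y ∩ T = T → (Y ∩ T).card = 3 → ∀ W ∈ H, W ∩ T = Y ∩ T → W ≠ Y →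
      X ∩ Y ∪ Z ∩ W ∈ H ∨ (X ∩ Y ∪ Z ∩ W).card ≤ 4

variable {hH : IsSparseFamily 5 H}

theorem sparsePaving_realRank_le (X : Finset α) : (sparsePaving H hH).realRank X ≤ 5 := by
  rw [sparsePaving_realRank]
  split_ifs
  · norm_num
  · exact_mod_cast min_le_right _ _

theorem sparsePaving_realRank_of_mem {X : Finset α} (hX : X ∈ H) :
    (sparsePaving H hH).realRank X = 4 := by
  rw [sparsePaving_realRank, if_pos hX]
  norm_num

theorem sparsePaving_realRank_of_notMem {X : Finset α} (hX : X ∉ H) (h : X.card ≤ 5) :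
    (sparsePaving H hH).realRank X = X.card := by
  rw [sparsePaving_realRank, if_neg hX, min_eq_left h]

theorem sparsePaving_realRank_of_lt_card {X : Finset α} (h : 5 < X.card) :
    (sparsePaving H hH).realRank X = 5 := by
  rw [sparsePaving_realRank, if_neg fun hX => (hH.card_eq _ hX).not_gt h, min_eq_right h.le]
  norm_num

theorem sparsePaving_realRank_le_card (X : Finset α) :
    (sparsePaving H hH).realRank X ≤ X.card := by
  by_cases hX : X ∈ H
  · rw [sparsePaving_realRank_of_mem hX, hH.card_eq _ hX]
    norm_num
  · rw [sparsePaving_realRank, if_neg hX]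
    exact_mod_cast min_le_left _ _

/-- A union that is no circuit-hyperplane is either spanning or independent. -/
theorem sparsePaving_spanning_or_modular {A B : Finset α} (h : A ∪ B ∉ H) :
    (∀ X, (sparsePaving H hH).realRank X ≤ (sparsePaving H hH).realRank (A ∪ B)) ∨
      (sparsePaving H hH).realRank A + (sparsePaving H hH).realRank B ≤
        (sparsePaving H hH).realRank (A ∪ B) + (sparsePaving H hH).realRank (A ∩ B) := by
  rcases le_or_gt (A ∪ B).card 5 with hc | hc
  · right
    -- If A ∩ B were a member, then A ∪ B, having at most five elements, would equal it.
    have hi : A ∩ B ∉ H := fun hi => h <| by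
      rwa [← eq_of_subset_of_card_le (inter_subset_union (s := A) (t := B))
        (hc.trans_eq (hH.card_eq _ hi).symm)]
    rw [sparsePaving_realRank_of_notMem h hc, sparsePaving_realRank_of_notMem hi
      ((card_le_card inter_subset_union).trans hc)]
    refine (add_le_add (sparsePaving_realRank_le_card A) (sparsePaving_realRank_le_card B)).trans ?_
    exact_mod_cast (card_union_add_card_inter A B).ge
  · left
    intro X
    rw [sparsePaving_realRank_of_lt_card hc]
    exact sparsePaving_realRank_le X

theorem sparsePaving_ingletonAt_of_union_notMem_outer {A B C D : Finset α} (h : A ∪ B ∉ H) :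
    IngletonAt (sparsePaving H hH).realRank A B C D :=
  (sparsePaving_spanning_or_modular h).elim
    (isPolymatroid_realRank _).ingletonAt_of_spanning_outer
    (isPolymatroid_realRank _).ingletonAt_of_modular_outer

theorem sparsePaving_ingletonAt_of_union_notMem_inner {A B C D : Finset α} (h : B ∪ C ∉ H) :
    IngletonAt (sparsePaving H hH).realRank A B C D :=
  (sparsePaving_spanning_or_modular h).elim
    (isPolymatroid_realRank _).ingletonAt_of_spanning_inner
    (isPolymatroid_realRank _).ingletonAt_of_modular_inner

/-- If an inner set has more than three elements, then all the unions agree. -/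
theorem sparsePaving_ingletonAt_of_card {A B C D : Finset α} (hAB : A ∪ B ∈ H)
    (hDB : D ∪ B ∈ H) (hAC : A ∪ C ∈ H) (hDC : D ∪ C ∈ H) (hBC : B ∪ C ∈ H) (hB : 3 < B.card) :
    IngletonAt (sparsePaving H hH).realRank A B C D := by
  have heq : ∀ X ∈ H, ∀ Y ∈ H, B ⊆ X → B ⊆ Y → X = Y := fun X hX Y hY hBX hBY => by
    by_contra hne
    have := hH.inter_card _ hX _ hY hne
    have := card_le_card (subset_inter hBX hBY)
    omega
  have h₁ := heq _ hAB _ hBC subset_union_right subset_union_left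
  have h₂ := heq _ hDB _ hBC subset_union_right subset_union_left
  have hle : ∀ X ⊆ B ∪ C, (sparsePaving H hH).realRank X ≤ 4 := fun X hX => by
    rw [← sparsePaving_realRank_of_mem (hH := hH) hBC]
    exact (isPolymatroid_realRank _).mono _ _ hX
  have hA : A ⊆ B ∪ C := h₁ ▸ subset_union_left
  have hD : D ⊆ B ∪ C := h₂ ▸ subset_union_left
  have := hle B subset_union_left
  have := hle C subset_union_right
  have := hle (A ∪ D) (union_subset hA hD)
  have := hle (A ∪ B ∪ C) (by grind)
  have := hle (D ∪ B ∪ C) (by grind)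
  rw [IngletonAt, sparsePaving_realRank_of_mem hAB, sparsePaving_realRank_of_mem hAC,
    sparsePaving_realRank_of_mem hDB, sparsePaving_realRank_of_mem hDC,
    sparsePaving_realRank_of_mem hBC]
  linarith

theorem sparsePaving_isIngletonCompliant (hV : NoVamosConfig H) :
    IsIngletonCompliant (sparsePaving H hH).realRank := by
  refine (isPolymatroid_realRank _).isIngletonCompliant fun A B C D => ?_
  by_cases hAB : A ∪ B ∈ H
  swap
  · exact sparsePaving_ingletonAt_of_union_notMem_outer hAB
  by_cases hAC : A ∪ C ∈ H
  swap
  · exact (sparsePaving_ingletonAt_of_union_notMem_outer hAC).swap_inner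
  by_cases hDB : D ∪ B ∈ H
  swap
  · exact (sparsePaving_ingletonAt_of_union_notMem_outer hDB).swap_outer
  by_cases hDC : D ∪ C ∈ H
  swap
  · exact (sparsePaving_ingletonAt_of_union_notMem_outer hDC).swap_inner.swap_outer
  by_cases hBC : B ∪ C ∈ H
  swap
  · exact sparsePaving_ingletonAt_of_union_notMem_inner hBC
  rcases lt_or_ge 3 B.card with hB | hB
  · exact sparsePaving_ingletonAt_of_card hAB hDB hAC hDC hBC hB
  rcases lt_or_ge 3 C.card with hC | hC
  · exact (sparsePaving_ingletonAt_of_card hAC hDC hAB hDB (union_comm B C ▸ hBC) hC).swap_inner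
  have hrB := sparsePaving_realRank_le_card (hH := hH) B
  have hrC := sparsePaving_realRank_le_card (hH := hH) C
  have h₁ := sparsePaving_realRank_le (hH := hH) (A ∪ B ∪ C)
  have h₂ := sparsePaving_realRank_le (hH := hH) (D ∪ B ∪ C)
  have h₃ := sparsePaving_realRank_le (hH := hH) (A ∪ D)
  rw [IngletonAt, sparsePaving_realRank_of_mem hAB, sparsePaving_realRank_of_mem hAC,
    sparsePaving_realRank_of_mem hDB, sparsePaving_realRank_of_mem hDC,
    sparsePaving_realRank_of_mem hBC]
  -- The right-hand side is 20, and the three unions on the left have rank at most 5 each. Failure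
  -- thus needs |B| = |C| = 3 and rank 5 for all three.
  by_cases hBC6 : B.card + C.card ≤ 5
  · have : (B.card : ℝ) + C.card ≤ 5 := by exact_mod_cast hBC6
    linarith
  have hB3 : B.card = 3 := by omega
  have hC3 : C.card = 3 := by omega
  rw [hB3] at hrB
  rw [hC3] at hrC
  push_cast at hrB hrC
  by_cases hA : A ∪ B ∪ C ∈ H
  · rw [sparsePaving_realRank_of_mem hA]
    linarith
  by_cases hD : D ∪ B ∪ C ∈ H
  · rw [sparsePaving_realRank_of_mem hD]
    linarith
  -- Distinct members meet in at most three points, so E ∪ F meets B ∪ C in F alone.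
  have htrace : ∀ E F G : Finset α, F.card = 3 → E ∪ F ∈ H → F ∪ G = B ∪ C →
      E ∪ F ∪ G ∉ H → (E ∪ F) ∩ (B ∪ C) = F := by
    intro E F G hF hEF hFG hEFG
    have hne : E ∪ F ≠ B ∪ C := fun h => hEFG <| by
      rwa [union_eq_left.2 (h ▸ hFG ▸ subset_union_right)]
    have := hH.inter_card _ hEF _ hBC hne
    exact (eq_of_subset_of_card_le (subset_inter subset_union_right
      (hFG ▸ subset_union_left)) (by omega)).symm
  have tAB := htrace A B C hB3 hAB rfl hA
  have tDB := htrace D B C hB3 hDB rfl hD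
  have tAC := htrace A C B hC3 hAC (union_comm _ _) (by rwa [union_right_comm])
  have tDC := htrace D C B hC3 hDC (union_comm _ _) (by rwa [union_right_comm])
  have hle : (sparsePaving H hH).realRank (A ∪ D) ≤ 4 := by
    by_cases heB : D ∪ B = A ∪ B
    · rw [← sparsePaving_realRank_of_mem (hH := hH) hAB]
      exact (isPolymatroid_realRank _).mono _ _ (union_subset subset_union_left
        (heB ▸ subset_union_left))
    by_cases heC : D ∪ C = A ∪ C
    · rw [← sparsePaving_realRank_of_mem (hH := hH) hAC]
      exact (isPolymatroid_realRank _).mono _ _ (union_subset subset_union_left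
        (heC ▸ subset_union_left))
    -- The union A ∪ D lies in the set bounded by `NoVamosConfig`, taken with T = B ∪ C.
    refine ((isPolymatroid_realRank _).mono _
      ((A ∪ B) ∩ (A ∪ C) ∪ (D ∪ B) ∩ (D ∪ C)) (by grind)).trans ?_
    rcases hV _ hBC _ hAB (by rw [tAB, hB3]) _ hDB (by rw [tAB, tDB]) heB _ hAC
      (by rw [tAB, tAC]) (by rw [tAC, hC3]) _ hDC (by rw [tAC, tDC]) heC with h | h
    · rw [sparsePaving_realRank_of_mem h]
    · exact (sparsePaving_realRank_le_card _).trans (by exact_mod_cast h)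
  linarith

end Matroid

/-! ### Common information -/

namespace IsPolymatroid

variable {Q : Type u} [DecidableEq Q] {f : Finset Q → ℝ}

/-- Throughout, `f (A ∪ X) ≤ f A` expresses that A determines X, that is, X lies in the closure of
A. -/
theorem determines_union (hf : IsPolymatroid f) {A B X : Finset Q} (h : f (A ∪ X) ≤ f A) :
    f (A ∪ B ∪ X) ≤ f (A ∪ B) := by
  have := hf.submodular_of_subset (X := A ∪ X) (Y := A ∪ B) (Z := A) (W := A ∪ B ∪ X)
    (by grind) (by grind)
  linarith

theorem determines_trans (hf : IsPolymatroid f) {A X Y : Finset Q} (hX : f (A ∪ X) ≤ f A)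
    (hY : f (X ∪ Y) ≤ f X) : f (A ∪ Y) ≤ f A := by
  have h₁ := hf.determines_union (B := A) hY
  have h₂ := hf.mono (A ∪ Y) (X ∪ A ∪ Y) (by grind)
  rw [union_comm X A] at h₁ h₂
  linarith

theorem determines_pair (hf : IsPolymatroid f) {A X Y : Finset Q} (hX : f (A ∪ X) ≤ f A)
    (hY : f (A ∪ Y) ≤ f A) : f (A ∪ (X ∪ Y)) ≤ f A := by
  have h := hf.determines_union (B := X) hY
  rw [← union_assoc]
  linarith

/-- What is determined by both `Y` and `Z` has, conditioned on `X`, at most the rank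
`f(Y : Z | X)`. -/
theorem rank_le_of_determined (hf : IsPolymatroid f) (X : Finset Q) {Y Z W : Finset Q}
    (hY : f (Y ∪ W) ≤ f Y) (hZ : f (Z ∪ W) ≤ f Z) :
    f (X ∪ W) + f (X ∪ Y ∪ Z) ≤ f (X ∪ Y) + f (X ∪ Z) := by
  have h₁ := hf.determines_union (B := X) hY
  have h₂ := hf.determines_union (B := X) hZ
  have h₃ := hf.submodular_of_subset (X := Y ∪ X ∪ W) (Y := Z ∪ X ∪ W) (Z := X ∪ W)
    (W := X ∪ Y ∪ Z) (by grind) (by grind)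
  rw [union_comm Y X] at h₁ h₃
  rw [union_comm Z X] at h₂ h₃
  linarith

end IsPolymatroid

theorem isCommonInfo_iff {Q : Type u} [DecidableEq Q] {f : Finset Q → ℝ} {A B X : Finset Q} :
    IsCommonInfo f A B X ↔
      f (A ∪ X) = f A ∧ f (B ∪ X) = f B ∧ f X = f A + f B - f (A ∪ B) - f ∅ := by
  simp only [IsCommonInfo, condRank, mutualRank, condMutual, union_assoc, union_self, empty_union]
  refine and_congr ?_ (and_congr ?_ Iff.rfl) <;> constructor <;> intro h <;> linarith

/-- Three rows and three columns of a grid in rank `5`, scaled by `c`: every row and every column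
span together a hyperplane, except for the middle ones, which span the whole space. If the first
row has a common information with each of the other two, then the middle row and the middle
column have no common point outside the first row. -/
theorem IsPolymatroid.grid_contradiction {Q : Type u} [DecidableEq Q] {f : Finset Q → ℝ}
    (hf : IsPolymatroid f) {c : ℝ} (hc : 0 < c) {R K : Fin 3 → Finset Q} {P q s : Finset Q}
    (hR : ∀ i, f (R i) = 3 * c) (hK : ∀ j, f (K j) = 3 * c)
    (hRK : ∀ i j, (i, j) ≠ (1, 1) → f (R i ∪ K j) = 4 * c) (hRK₁ : f (R 1 ∪ K 1) = 5 * c)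
    (hRR : ∀ i j, i ≠ j → f (R i ∪ R j) = 5 * c) (hKK : f (K 0 ∪ K 2) = 5 * c)
    (hKRR : ∀ i j k, i ≠ j → f (K k ∪ R i ∪ R j) = 5 * c)
    (hPR : P ⊆ R 1) (hPK : P ⊆ K 1) (hRP : f (R 0 ∪ P) = 4 * c)
    (hq : IsCommonInfo f (R 0) (R 1) q) (hs : IsCommonInfo f (R 0) (R 2) s) : False := by
  rw [isCommonInfo_iff, hf.map_empty] at hq hs
  obtain ⟨hq₀, hq₁, hq⟩ := hq
  obtain ⟨hs₀, hs₂, hs⟩ := hs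
  rw [hR, hR, hRR _ _ (by decide)] at hq hs
  -- Given a column, two rows that each span rank 4c with it and together rank 5c have conditional
  -- mutual rank 4c + 4c - 5c - 3c = 0, so the column determines whatever both rows determine.
  have hKdet : ∀ i j k, ∀ x : Finset Q, i ≠ j → (i, k) ≠ (1, 1) → (j, k) ≠ (1, 1) →
      f (R i ∪ x) = f (R i) → f (R j ∪ x) = f (R j) → f (K k ∪ x) ≤ f (K k) := by
    intro i j k x hij hi hj hxi hxj
    have h := hf.rank_le_of_determined (K k) hxi.le hxj.le
    rw [hKRR _ _ _ hij, union_comm (K k) (R i), union_comm (K k) (R j), hRK _ _ hi,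
      hRK _ _ hj] at h
    rw [hK]
    linarith
  -- Columns 0 and 2 have mutual rank c, which is already the rank of q; hence q determines s.
  have hqs := hf.rank_le_of_determined ∅
    (hf.determines_pair (hKdet 0 1 0 q (by decide) (by decide) (by decide) hq₀ hq₁)
      (hKdet 0 2 0 s (by decide) (by decide) (by decide) hs₀ hs₂))
    (hf.determines_pair (hKdet 0 1 2 q (by decide) (by decide) (by decide) hq₀ hq₁)
      (hKdet 0 2 2 s (by decide) (by decide) (by decide) hs₀ hs₂))
  simp only [empty_union, hKK, hK] at hqs
  have hRs : f (R 1 ∪ s) ≤ f (R 1) := hf.determines_trans hq₁.le (by linarith)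
  -- The middle row and column have mutual rank c, the rank of s; hence s determines P.
  have hsP := hf.rank_le_of_determined ∅
    (hf.determines_pair hRs (by rw [union_eq_left.2 hPR]))
    (hf.determines_pair (hKdet 0 2 1 s (by decide) (by decide) (by decide) hs₀ hs₂)
      (by rw [union_eq_left.2 hPK]))
  simp only [empty_union, hRK₁, hK, hR] at hsP
  have hRP' : f (R 0 ∪ P) ≤ f (R 0) := hf.determines_trans hs₀.le (by linarith)
  rw [hRP, hR] at hRP'
  linarith

/-! ### Linear polymatroids are CI-compliant -/

theorem IsLinearPolymatroid.isPolymatroid {F : Type v} [Field F] {Q : Type u} [DecidableEq Q]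
    {f : Finset Q → ℝ} (h : IsLinearPolymatroid F f) : IsPolymatroid f := by
  obtain ⟨V, _, _, _, W, hW⟩ := h
  refine ⟨by simp [hW], fun X Y hXY => ?_, fun X Y => ?_⟩
  · rw [hW, hW]
    exact_mod_cast Submodule.finrank_mono (biSup_mono fun x hx => hXY hx)
  · rw [hW, hW, hW, hW, Finset.iSup_union]
    have h₁ := Submodule.finrank_sup_add_finrank_inf_eq (⨆ x ∈ X, W x) (⨆ x ∈ Y, W x)
    have h₂ : (⨆ x ∈ X ∩ Y, W x) ≤ (⨆ x ∈ X, W x) ⊓ (⨆ x ∈ Y, W x) :=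
      le_inf (biSup_mono fun x hx => (mem_inter.1 hx).1) (biSup_mono fun x hx => (mem_inter.1 hx).2)
    have h₃ := Submodule.finrank_mono h₂
    norm_cast
    omega

/-- The intersection of the two spanned subspaces, adjoined as a new point, is a common information,
and the extension is again linear, so the induction continues. -/
theorem IsLinearPolymatroid.isKCICompliant {F : Type v} [Field F] (k : ℕ) :
    ∀ {Q : Type u} [DecidableEq Q] {f : Finset Q → ℝ}, IsLinearPolymatroid F f →
      IsKCICompliant k f := by
  induction k with
  | zero => intros; trivial
  | succ k ih =>
    intro Q _ f h A B
    obtain ⟨V, _, _, _, W, hW⟩ := h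
    let S : Finset Q → Submodule F V := fun X => ⨆ x ∈ X, W x
    let W' : Option Q → Submodule F V := fun o => o.elim (S A ⊓ S B) W
    let rk : Submodule F V → ℝ := fun U => (Module.finrank F U : ℝ)
    let f' : Finset (Option Q) → ℝ := fun X => rk (⨆ x ∈ X, W' x)
    have hf' : IsLinearPolymatroid F f' := ⟨V, _, _, ‹_›, W', fun _ => rfl⟩
    have hmap : ∀ X : Finset Q, (⨆ x ∈ X.map Function.Embedding.some, W' x) = S X := fun X => by
      simp [S, W', iSup_and, iSup_comm (ι := Option Q)]
    have hnone : (⨆ x ∈ ({none} : Finset (Option Q)), W' x) = S A ⊓ S B := by simp [W']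
    refine ⟨f', ⟨hf'.isPolymatroid, fun X => ?_⟩, ?_, ih hf'⟩
    · simp only [f', hmap]
      exact (hW X).symm
    · rw [isCommonInfo_iff, hf'.isPolymatroid.map_empty]
      simp only [f', Finset.iSup_union, hmap, hnone]
      refine ⟨by rw [sup_eq_left.2 inf_le_left], by rw [sup_eq_left.2 inf_le_right], ?_⟩
      have : rk (S A ⊔ S B) + rk (S A ⊓ S B) = rk (S A) + rk (S B) := by
        simp only [rk]
        exact_mod_cast Submodule.finrank_sup_add_finrank_inf_eq (S A) (S B)
      linarith

/-! ### An invariant of set families -/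

/-- An isomorphism invariant of a family of finite sets. -/
def tripleInvariant {α : Type u} [DecidableEq α] (H : Finset (Finset α)) : ℕ :=
  ∑ A ∈ H, (∑ B ∈ H, ∑ C ∈ H, 2 ^ (A ∩ B ∩ C).card) ^ 2

theorem tripleInvariant_map {α : Type u} [DecidableEq α] (H : Finset (Finset α)) (e : α ≃ α) :
    tripleInvariant (H.map (mapEmbedding e.toEmbedding).toEmbedding) = tripleInvariant H := by
  simp only [tripleInvariant, sum_map, RelEmbedding.coe_toEmbedding, mapEmbedding_apply,
    ← map_inter, card_map]

/-! ### Sets of cells as binary numbers -/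

/-- The number of binary digits `1` of a number below `512` with at most six of them: the digit
sum of an octal number whose digits count the digits `1` in blocks of three. -/
def digitCount (m : ℕ) : ℕ :=
  Nat.mod (Nat.sub (Nat.sub m (Nat.land (Nat.shiftRight m 1) 219))
    (Nat.land (Nat.shiftRight m 2) 73)) 7

/-- In octal, 219 is 333 and 73 is 111: a block 4a + 2b + c loses 2a + b and then a, leaving a + b +
c. The digit sum is read off modulo 7 because 8 ≡ 1. -/
theorem card_cellsOf_mod : ∀ m < 512, (cellsOf m).card % 7 = digitCount m := by
  decide +kernel

theorem card_cellsOf {m : ℕ} (hm : m < 512) (h : (cellsOf m).card ≤ 6) :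
    (cellsOf m).card = digitCount m := by
  rw [← card_cellsOf_mod m hm, Nat.mod_eq_of_lt (by omega)]

theorem cellsOf_land (m n : ℕ) : cellsOf (m &&& n) = cellsOf m ∩ cellsOf n := by
  ext q
  simp [cellsOf]

theorem cellsOf_lor (m n : ℕ) : cellsOf (m ||| n) = cellsOf m ∪ cellsOf n := by
  ext q
  simp [cellsOf]

theorem cellsOf_injOn {m n : ℕ} (hm : m < 512) (hn : n < 512) (h : cellsOf m = cellsOf n) :
    m = n := by
  refine Nat.eq_of_testBit_eq fun i => ?_
  by_cases hi : i < 9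
  · have h₁ : ((⟨i / 3, by omega⟩, ⟨i % 3, by omega⟩) : Cell) ∈ cellsOf m ↔
        ((⟨i / 3, by omega⟩, ⟨i % 3, by omega⟩) : Cell) ∈ cellsOf n := by rw [h]
    simp only [cellsOf, mem_filter, mem_univ, true_and, Nat.div_add_mod] at h₁
    exact Bool.eq_iff_iff.2 h₁
  · have : 2 ^ 9 ≤ 2 ^ i := Nat.pow_le_pow_right (by norm_num) (by omega)
    rw [Nat.testBit_lt_two_pow (by omega), Nat.testBit_lt_two_pow (by omega)]

/-- The family of sets of cells coded by a list of numbers. -/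
def familyOf (L : List ℕ) : Finset (Finset Cell) :=
  (L.map cellsOf).toFinset

theorem mem_familyOf {L : List ℕ} {A : Finset Cell} :
    A ∈ familyOf L ↔ ∃ a ∈ L, cellsOf a = A := by
  simp [familyOf]

theorem cellsOf_mem_familyOf {L : List ℕ} (hL : ∀ a ∈ L, a < 512) {a : ℕ} (ha : a < 512) :
    cellsOf a ∈ familyOf L ↔ a ∈ L := by
  rw [mem_familyOf]
  refine ⟨?_, fun h => ⟨a, h, rfl⟩⟩
  rintro ⟨b, hb, h⟩
  rwa [← cellsOf_injOn (hL b hb) ha h]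

/-- The codes of the circuit-hyperplanes of a matroid of the list. -/
def fullCodes (L : List ℕ) : List ℕ :=
  -- The codes of the eight non-central crosses.
  79 :: 151 :: 295 :: 121 :: 316 :: 457 :: 466 :: 484 :: L

theorem listedCircuitHyperplanes_eq (k : Fin 171) :
    listedCircuitHyperplanes k =
      familyOf (fullCodes (furtherCodes.get (k.cast furtherCodes_length.symm))) := by
  have h : ticTacToe = ([79, 151, 295, 121, 316, 457, 466, 484].map cellsOf).toFinset := by
    decide +kernel
  rw [listedCircuitHyperplanes, familyOf, h, ← List.toFinset_append, ← List.map_append]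
  rfl

/-! ### Checks on lists of codes

These are written with the recursor of lists and the operations of `ℕ` that the kernel evaluates
directly. -/

/-- All elements of `L` that satisfy `p` satisfy `q`. -/
noncomputable def allImp (p q : ℕ → Bool) (L : List ℕ) : Bool :=
  List.rec true (fun a _ ih => cond (p a) (cond (q a) ih false) ih) L

theorem allImp_iff {p q : ℕ → Bool} {L : List ℕ} :
    allImp p q L = true ↔ ∀ a ∈ L, p a = true → q a = true := by
  induction L with
  | nil => simp [allImp]
  | cons a L ih =>
    have h : allImp p q (a :: L) = cond (p a) (cond (q a) (allImp p q L) false) (allImp p q L) :=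
      rfl
    rw [h, List.forall_mem_cons]
    cases p a <;> cases q a <;> simp [ih]

/-- The sum of the values of `g` on `L`. -/
noncomputable def sumOver (g : ℕ → ℕ) (L : List ℕ) : ℕ :=
  List.rec 0 (fun a _ ih => Nat.add (g a) ih) L

theorem sumOver_eq (g : ℕ → ℕ) (L : List ℕ) : sumOver g L = (L.map g).sum := by
  induction L with
  | nil => rfl
  | cons a L ih => rw [List.map_cons, List.sum_cons, ← ih]; rfl

/-- `familyOf L` is a sparse family of sets with five elements. -/
noncomputable def sparseCheck (L : List ℕ) : Bool :=
  decide L.Nodup && allImp (fun _ => true) (fun a => decide (a < 512) &&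
    decide ((cellsOf a).card = 5) &&
    allImp (fun b => !Nat.beq a b) (fun b => Nat.ble (digitCount (Nat.land a b)) 3) L) L

/-- `familyOf L` satisfies `Matroid.NoVamosConfig`. -/
noncomputable def vamosCheck (L : List ℕ) : Bool :=
  allImp (fun _ => true) (fun t =>
    allImp (fun x => Nat.beq (digitCount (Nat.land x t)) 3) (fun x =>
      allImp (fun z => Nat.beq (Nat.land z t) (Nat.land x t)) (fun z => Nat.beq z x ||
        allImp (fun y => Nat.beq (Nat.lor (Nat.land x t) (Nat.land y t)) t) (fun y =>
          !Nat.beq (digitCount (Nat.land y t)) 3 ||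
          allImp (fun w => Nat.beq (Nat.land w t) (Nat.land y t)) (fun w => Nat.beq w y ||
            -- This union need not lie in a five-element set, so its size is counted directly rather
            -- than by `digitCount`, which is reliable only up to six.
            decide (x &&& y ||| z &&& w ∈ L ∨ (cellsOf (x &&& y ||| z &&& w)).card ≤ 4)) L) L) L) L) L

/-- The invariant of `familyOf L`. -/
noncomputable def codeInvariant (L : List ℕ) : ℕ :=
  sumOver (fun a => Nat.pow (sumOver (fun b => sumOver (fun c =>
    Nat.pow 2 (digitCount (Nat.land (Nat.land a b) c))) L) L) 2) L

theorem furtherCodes_sparseCheck : ∀ L ∈ furtherCodes, sparseCheck (fullCodes L) = true := by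
  decide +kernel

theorem furtherCodes_vamosCheck : ∀ L ∈ furtherCodes, vamosCheck (fullCodes L) = true := by
  decide +kernel

/-- The number 186 codes the central cross, which must stay a basis. -/
theorem furtherCodes_center : ∀ L ∈ furtherCodes, 186 ∉ fullCodes L := by
  decide +kernel

/-- This separates the isomorphism classes, and it also shows that the table has no repeated entry.
-/
theorem furtherCodes_codeInvariant_nodup :
    (furtherCodes.map fun L => codeInvariant (fullCodes L)).Nodup := by
  decide +kernel

/-! ### Soundness of the checks -/

section Soundness

variable {L : List ℕ}

theorem sparseCheck_iff : sparseCheck L = true ↔ L.Nodup ∧ ∀ a ∈ L, a < 512 ∧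
    (cellsOf a).card = 5 ∧ ∀ b ∈ L, a ≠ b → digitCount (a &&& b) ≤ 3 := by
  simp only [sparseCheck, Bool.and_eq_true, decide_eq_true_eq, allImp_iff, Bool.not_eq_true',
    ← Bool.not_eq_true, Nat.beq_eq, Nat.ble_eq, true_implies, and_assoc]
  rfl

theorem card_cellsOf_land {a : ℕ} (b : ℕ) (ha : a < 512) (hc : (cellsOf a).card = 5) :
    (cellsOf (a &&& b)).card = digitCount (a &&& b) := by
  refine card_cellsOf (Nat.and_le_left.trans_lt ha) ?_
  rw [cellsOf_land]
  have := card_le_card (inter_subset_left (s₁ := cellsOf a) (s₂ := cellsOf b))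
  omega

theorem isSparseFamily_familyOf (h : sparseCheck L = true) :
    Matroid.IsSparseFamily 5 (familyOf L) := by
  obtain ⟨-, h⟩ := sparseCheck_iff.1 h
  refine ⟨by norm_num, fun A hA => ?_, fun A hA B hB hne => ?_⟩
  · obtain ⟨a, ha, rfl⟩ := mem_familyOf.1 hA
    exact (h a ha).2.1
  · obtain ⟨a, ha, rfl⟩ := mem_familyOf.1 hA
    obtain ⟨b, hb, rfl⟩ := mem_familyOf.1 hB
    have h₁ := (h a ha).2.2 b hb (fun e => hne (e ▸ rfl))
    rw [← cellsOf_land, card_cellsOf_land b (h a ha).1 (h a ha).2.1]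
    omega

theorem noVamosConfig_familyOf (h : sparseCheck L = true) (hV : vamosCheck L = true) :
    Matroid.NoVamosConfig (familyOf L) := by
  obtain ⟨-, h⟩ := sparseCheck_iff.1 h
  have hlt : ∀ {a b}, a ∈ L → a &&& b < 512 := fun ha => Nat.and_le_left.trans_lt (h _ ha).1
  have hinj : ∀ {a b t}, a ∈ L → b ∈ L → cellsOf a ∩ cellsOf t = cellsOf b ∩ cellsOf t →
      a &&& t = b &&& t := fun ha hb he => by
    rw [← cellsOf_land, ← cellsOf_land] at he
    exact cellsOf_injOn (hlt ha) (hlt hb) he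
  have hcard : ∀ {a t}, a ∈ L → (cellsOf a ∩ cellsOf t).card = 3 → digitCount (a &&& t) = 3 :=
    fun {a t} ha hc => by
      rw [← cellsOf_land, card_cellsOf_land t (h a ha).1 (h a ha).2.1] at hc
      exact hc
  simp only [vamosCheck, allImp_iff, Bool.or_eq_true, Bool.not_eq_true', ← Bool.not_eq_true,
    Nat.beq_eq, decide_eq_true_eq, true_implies] at hV
  intro T hT X hX hXT Z hZ hZT hZX Y hY hXYT hYT W hW hWT hWY
  obtain ⟨t, ht, rfl⟩ := mem_familyOf.1 hT
  obtain ⟨x, hx, rfl⟩ := mem_familyOf.1 hX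
  obtain ⟨y, hy, rfl⟩ := mem_familyOf.1 hY
  obtain ⟨z, hz, rfl⟩ := mem_familyOf.1 hZ
  obtain ⟨w, hw, rfl⟩ := mem_familyOf.1 hW
  have hxyt : (x &&& t) ||| (y &&& t) = t := by
    refine cellsOf_injOn (Nat.or_lt_two_pow (n := 9) (hlt hx) (hlt hy)) (h t ht).1 ?_
    rwa [cellsOf_lor, cellsOf_land, cellsOf_land]
  have hres := (((hV t ht x hx (hcard hx hXT) z hz (hinj hz hx hZT)).resolve_left
    (fun e => hZX (e ▸ rfl)) y hy hxyt).resolve_left (fun e => e (hcard hy hYT)) w hw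
    (hinj hw hy hWT)).resolve_left (fun e => hWY (e ▸ rfl))
  rw [← cellsOf_land, ← cellsOf_land, ← cellsOf_lor]
  exact hres.imp_left fun hm => mem_familyOf.2 ⟨_, hm, rfl⟩

theorem tripleInvariant_familyOf (h : sparseCheck L = true) :
    tripleInvariant (familyOf L) = codeInvariant L := by
  obtain ⟨hnd, h⟩ := sparseCheck_iff.1 h
  have hsum : ∀ g : Finset Cell → ℕ, ∑ A ∈ familyOf L, g A = sumOver (fun a => g (cellsOf a)) L := by
    intro g
    rw [familyOf, List.sum_toFinset, sumOver_eq, List.map_map]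
    · rfl
    · exact hnd.map_on fun a ha b hb e => cellsOf_injOn (h a ha).1 (h b hb).1 e
  simp only [tripleInvariant, hsum, codeInvariant, sumOver_eq]
  refine congrArg List.sum (List.map_congr_left fun a ha => congrArg (· ^ 2) ?_)
  refine congrArg List.sum (List.map_congr_left fun b _ => ?_)
  refine congrArg List.sum (List.map_congr_left fun c _ => ?_)
  -- Reassociating exhibits the triple intersection as a part of the five-element set coded by a.
  rw [← cellsOf_land, ← cellsOf_land, Nat.land_assoc,
    card_cellsOf_land _ (h a ha).1 (h a ha).2.1, ← Nat.land_assoc]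
  rfl

end Soundness

/-! ### Failure of CI-compliance on the grid -/

/-- A row of the grid. -/
def gridRow (i : Fin 3) : Finset Cell := univ.filter fun q => q.1 = i

/-- A column of the grid. -/
def gridCol (j : Fin 3) : Finset Cell := univ.filter fun q => q.2 = j

theorem gridRow_union_gridCol (i j : Fin 3) : gridRow i ∪ gridCol j = cross (i, j) := by
  rw [gridRow, gridCol, cross, filter_or]

theorem not_isKCICompliant_two {H : Finset (Finset Cell)} {hH : Matroid.IsSparseFamily 5 H}
    (hmem : ∀ p : Cell, p ≠ (1, 1) → cross p ∈ H) (hcenter : cross (1, 1) ∉ H) {c : ℝ}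
    (hc : 0 < c) :
    ¬ IsKCICompliant 2 (fun X => c * (Matroid.sparsePaving H hH).realRank X) := by
  intro h
  -- The first extension adds q for rows 0 and 1, the second adds s for rows 0 and 2.
  obtain ⟨f, ⟨-, hf⟩, hq, h⟩ := h (gridRow 0) (gridRow 1)
  obtain ⟨g, ⟨hgp, hg⟩, hs, -⟩ := h ((gridRow 0).map .some) ((gridRow 2).map .some)
  let φ : Finset Cell → Finset (Option (Option Cell)) := fun X => (X.map .some).map .some
  have hφ : ∀ X, g (φ X) = c * (Matroid.sparsePaving H hH).realRank X := fun X => by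
    rw [hg, hf]
  have hun : ∀ X Y, φ X ∪ φ Y = φ (X ∪ Y) := fun X Y => by simp only [φ, map_union]
  have hsmall : ∀ X : Finset Cell, X.card < 5 → g (φ X) = X.card * c := fun X hX => by
    rw [hφ, Matroid.sparsePaving_realRank_of_notMem (fun h => hX.ne (hH.card_eq _ h)) hX.le,
      mul_comm]
  have hlarge : ∀ X : Finset Cell, 5 < X.card → g (φ X) = 5 * c := fun X hX => by
    rw [hφ, Matroid.sparsePaving_realRank_of_lt_card hX, mul_comm]
  refine hgp.grid_contradiction hc (R := fun i => φ (gridRow i)) (K := fun j => φ (gridCol j))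
    (P := φ {(1, 1)}) (q := ({none} : Finset (Option Cell)).map .some) (s := {none})
    ?_ ?_ ?_ ?_ ?_ ?_ ?_ ?_ ?_ ?_ ?_ hs
  · intro i
    have h : (gridRow i).card = 3 := by decide +revert
    rw [hsmall _ (by omega), h]; norm_num
  · intro j
    have h : (gridCol j).card = 3 := by decide +revert
    rw [hsmall _ (by omega), h]; norm_num
  · intro i j hij
    rw [hun, gridRow_union_gridCol, hφ, Matroid.sparsePaving_realRank_of_mem (hmem _ hij), mul_comm]
  · have h : (cross (1, 1)).card = 5 := by decide
    rw [hun, gridRow_union_gridCol, hφ, Matroid.sparsePaving_realRank_of_notMem hcenter h.le, h,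
      mul_comm]
    norm_num
  · intro i j hij
    rw [hun]
    exact hlarge _ (by decide +revert)
  · rw [hun]
    exact hlarge _ (by decide)
  · intro i j k hij
    rw [hun, hun]
    exact hlarge _ (by decide +revert)
  · exact map_subset_map.2 (map_subset_map.2 (by decide))
  · exact map_subset_map.2 (map_subset_map.2 (by decide))
  · have h : (gridRow 0 ∪ {(1, 1)}).card = 4 := by decide
    rw [hun, hsmall _ (by omega), h]; norm_num
  · rw [isCommonInfo_iff] at hq ⊢
    -- Writing the empty set as an image turns every value of `g` into a value of `f`, so q keeps
    -- its property in the second extension.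
    rw [← map_empty (Function.Embedding.some : Option Cell ↪ _)]
    simp only [φ, ← map_union, hg]
    exact hq

/-! ### The 171 matroids -/

theorem mainTheorem7 :
    ∃ M : Fin 171 → Matroid Cell,
      -- the `k`-th matroid is the sparse paving matroid of rank `5` on the nine cells
      -- with the listed circuit-hyperplanes
      (∀ k, (M k).E = Set.univ ∧ (M k).eRank = 5 ∧ (M k).IsSparsePaving ∧
        ∀ C : Finset Cell,
          (M k).IsCircuitHyperplane (C : Set Cell) ↔ C ∈ listedCircuitHyperplanes k) ∧
      -- the first one is the tic-tac-toe matroid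
      (∀ C : Finset Cell,
        (M 0).IsCircuitHyperplane (C : Set Cell) ↔ ∃ p : Cell, p ≠ (1, 1) ∧ C = cross p) ∧
      -- they are pairwise non-isomorphic
      (∀ k l, (M k).IsIsomorphic (M l) → k = l) ∧
      -- compliance
      (∀ k, IsIngletonCompliant (M k).realRank ∧ ¬ IsCICompliant (M k).realRank) ∧
      -- none of them is folded linear, over fields in any universe
      (∀ k, ¬ IsFoldedLinear.{0, v} (M k).realRank) := by
  let L : Fin 171 → List ℕ := fun k => furtherCodes.get (k.cast furtherCodes_length.symm)
  have hLmem : ∀ k, L k ∈ furtherCodes := fun k => List.get_mem _ _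
  have hcheck : ∀ k, sparseCheck (fullCodes (L k)) = true := fun k =>
    furtherCodes_sparseCheck _ (hLmem k)
  have hfam : ∀ k, listedCircuitHyperplanes k = familyOf (fullCodes (L k)) :=
    listedCircuitHyperplanes_eq
  have hH : ∀ k, Matroid.IsSparseFamily 5 (listedCircuitHyperplanes k) := fun k => by
    rw [hfam]
    exact isSparseFamily_familyOf (hcheck k)
  have hd : 5 < Fintype.card Cell := by decide
  have hcross : ∀ k, ∀ p : Cell, p ≠ (1, 1) → cross p ∈ listedCircuitHyperplanes k :=
    fun k p hp => mem_union_left _ (mem_image_of_mem _ (by simpa using hp))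
  have hcenter : ∀ k, cross (1, 1) ∉ listedCircuitHyperplanes k := fun k => by
    have h : cross (1, 1) = cellsOf 186 := by decide +kernel
    rw [hfam, h, cellsOf_mem_familyOf (fun a ha => ((sparseCheck_iff.1 (hcheck k)).2 a ha).1)
      (by norm_num)]
    exact furtherCodes_center _ (hLmem k)
  refine ⟨fun k => Matroid.sparsePaving (listedCircuitHyperplanes k) (hH k), fun k =>
    ⟨rfl, Matroid.sparsePaving_eRank hd, Matroid.sparsePaving_isSparsePaving hd,
      Matroid.sparsePaving_isCircuitHyperplane_iff hd⟩, fun C => ?_, fun k l hkl => ?_,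
    fun k => ⟨Matroid.sparsePaving_isIngletonCompliant ?_, fun h => ?_⟩, fun k => ?_⟩
  · have h : listedCircuitHyperplanes 0 = ticTacToe := union_empty _
    rw [Matroid.sparsePaving_isCircuitHyperplane_iff hd, h]
    simp [ticTacToe, eq_comm]
  · obtain ⟨e, he⟩ := Matroid.exists_map_eq_of_isIsomorphic hkl
    have h := tripleInvariant_map (listedCircuitHyperplanes k) e
    rw [← he, hfam, hfam, tripleInvariant_familyOf (hcheck k),
      tripleInvariant_familyOf (hcheck l)] at h
    have h' := List.inj_on_of_nodup_map furtherCodes_codeInvariant_nodup (hLmem k) (hLmem l) h.symm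
    exact Fin.cast_injective _
      (furtherCodes_codeInvariant_nodup.of_map.injective_get h')
  · rw [hfam]
    exact noVamosConfig_familyOf (hcheck k) (furtherCodes_vamosCheck _ (hLmem k))
  · refine not_isKCICompliant_two (hH := hH k) (hcross k) (hcenter k) one_pos ?_
    simpa only [one_mul] using h 2 (by norm_num)
  · rintro ⟨F, _, ℓ, hℓ, hlin⟩
    -- The folding multiplicity ℓ serves as the scaling factor c.
    exact not_isKCICompliant_two (hH := hH k) (hcross k) (hcenter k)
      (Nat.cast_pos.2 hℓ) (hlin.isKCICompliant 2)
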